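/- Let $X$ be a real topological vector space and $\Omega\subset X$ a nonempty convex set. Write $\operatorname{cone}(A)=\{ta : t\ge 0,\ a\in A\}$ and set $$\operatorname{ri}(\Omega)=\{x\in\Omega : V\cap\overline{\operatorname{aff}}(\Omega)\subset\Omega\text{ for some neighborhood }V\text{ of }x\},$$ where $\overline{\operatorname{aff}}(\Omega)$ is the closure of the affine hull of $\Omega$, $$\operatorname{iri}(\Omega)=\{x\in\Omega : \operatorname{cone}(\Omega-x)\text{ is a linear subspace of }X\},$$ $$\operatorname{qri}(\Omega)=\{x\in\Omega : \overline{\operatorname{cone}(\Omega-x)}\text{ is a linear subspace of }X\}.$$ The set $\Omega$ is called quasi-regular if $\operatorname{qri}(\Omega)=\operatorname{iri}(\Omega)$. If $X$ is a normed space with dual $X^*$, put $N(x;\Omega)=\{x^*\in X^* : \langle x^*,y-x\rangle\le 0\text{ for all }y\in\Omega\}$ for $x\in\Omega$; a nonempty closed convex set $\Omega$ is called sequentially normally compact (SNC) if for every $\bar x\in\Omega$, every sequence $(x_k)$ in $\Omega$ with $x_k\to\bar x$, and all $x_k^*\in N(x_k;\Omega)$ such that $x_k^*\to 0$ in the weak$^*$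 topology of $X^*$, one has $\|x_k^*\|\to 0$. **Theorem 3.8.** A nonempty convex set $\Omega\subset X$ is quasi-regular under each of the following conditions: (a) $X$ is a finite-dimensional Hausdorff topological vector space; (b) $X$ is a locally convex topological vector space (not necessarily Hausdorff) and $\operatorname{int}(\Omega)\neq\emptyset$; (c) $X$ is a locally convex topological vector space (not necessarily Hausdorff) and $\operatorname{ri}(\Omega)\neq\emptyset$; (d) $X$ is a real Hilbert space, and $\Omega$ is closed and SNC with $\operatorname{iri}(\Omega)\neq\emptyset$. -/

import Mathlib

open Filter Topology

universe u

/-- The conic hull `cone A = {t a | t ≥ 0, a ∈ A}`. -/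
def conicHull {X : Type*} [AddCommGroup X] [Module ℝ X] (A : Set X) : Set X :=
  {z | ∃ t : ℝ, 0 ≤ t ∧ ∃ a ∈ A, z = t • a}

/-- The set `A` is (the underlying set of) a linear subspace of `X`. -/
def IsLinearSubspace {X : Type*} [AddCommGroup X] [Module ℝ X] (A : Set X) : Prop :=
  ∃ S : Submodule ℝ X, (S : Set X) = A

/-- The relative interior `ri Ω`, taken with respect to the closure of the affine hull of `Ω`. -/
def relativeInterior {X : Type*} [AddCommGroup X] [Module ℝ X] [TopologicalSpace X]
    (Ω : Set X) : Set X :=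
  {x | x ∈ Ω ∧ ∃ V ∈ 𝓝 x, V ∩ closure (affineSpan ℝ Ω : Set X) ⊆ Ω}

/-- The intrinsic relative interior `iri Ω`: the points `x ∈ Ω` such that `cone (Ω - x)` is a
linear subspace. -/
def intrinsicRelativeInterior {X : Type*} [AddCommGroup X] [Module ℝ X] (Ω : Set X) : Set X :=
  {x | x ∈ Ω ∧ IsLinearSubspace (conicHull ((fun y => y - x) '' Ω))}

/-- The quasi-relative interior `qri Ω`: the points `x ∈ Ω` such that the closure of
`cone (Ω - x)` is a linear subspace. -/
def quasiRelativeInterior {X : Type*} [AddCommGroup X] [Module ℝ X] [TopologicalSpace X]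
    (Ω : Set X) : Set X :=
  {x | x ∈ Ω ∧ IsLinearSubspace (closure (conicHull ((fun y => y - x) '' Ω)))}

/-- A (convex) set `Ω` is quasi-regular if `qri Ω = iri Ω`. -/
def IsQuasiRegular {X : Type*} [AddCommGroup X] [Module ℝ X] [TopologicalSpace X]
    (Ω : Set X) : Prop :=
  quasiRelativeInterior Ω = intrinsicRelativeInterior Ω

/-- The normal cone `N(x; Ω)`, a subset of the topological dual; it is empty if `x ∉ Ω`. -/
def normalCone {X : Type*} [NormedAddCommGroup X] [NormedSpace ℝ X] (x : X) (Ω : Set X) :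
    Set (StrongDual ℝ X) :=
  {f | x ∈ Ω ∧ ∀ y ∈ Ω, f (y - x) ≤ 0}

/-- `Ω` is sequentially normally compact at `x₀`: along sequences `x k → x₀` in `Ω`, every
weak-star null sequence of normals `f k ∈ N(x k; Ω)` is norm null. -/
def IsSNCAt {X : Type*} [NormedAddCommGroup X] [NormedSpace ℝ X] (Ω : Set X) (x₀ : X) : Prop :=
  ∀ (x : ℕ → X) (f : ℕ → StrongDual ℝ X),
    (∀ k, x k ∈ Ω) → Tendsto x atTop (𝓝 x₀) →
    (∀ k, f k ∈ normalCone (x k) Ω) →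
    Tendsto (fun k => StrongDual.toWeakDual (f k)) atTop (𝓝 (0 : WeakDual ℝ X)) →
    Tendsto (fun k => ‖f k‖) atTop (𝓝 0)

/-- `Ω` is sequentially normally compact (SNC): it is so at each of its points. -/
def IsSNC {X : Type*} [NormedAddCommGroup X] [NormedSpace ℝ X] (Ω : Set X) : Prop :=
  ∀ x₀ ∈ Ω, IsSNCAt Ω x₀

/-! Closures of subspaces are subspaces, so iri lies in qri. The converse follows once ri is
nonempty: for `x` in qri, the cone of `Ω - x` is convex and dense in its closure `T`, and a point of
ri gives it interior in `T`, so it is all of `T`. Each case thus reduces to producing a point of ri.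
Under SNC every point of iri is one: otherwise, projecting nearby points of the closed affine hull
outside `Ω` yields unit normals that are weak-star null. -/

theorem subset_conicHull {X : Type*} [AddCommGroup X] [Module ℝ X] (A : Set X) :
    A ⊆ conicHull A :=
  fun a ha => ⟨1, zero_le_one, a, ha, by simp⟩

theorem Convex.conicHull {X : Type*} [AddCommGroup X] [Module ℝ X] {A : Set X}
    (hA : Convex ℝ A) : Convex ℝ (conicHull A) := by
  rintro _ ⟨t, ht, a, ha, rfl⟩ _ ⟨s, hs, b, hb, rfl⟩ p q hp hq -
  obtain ⟨z, hz, h⟩ := hA.exists_mem_add_smul_eq ha hb (mul_nonneg hp ht) (mul_nonneg hq hs)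
  exact ⟨p * t + q * s, by positivity, z, hz, by rw [h, smul_smul, smul_smul]⟩

theorem Convex.image_sub_const {X : Type*} [AddCommGroup X] [Module ℝ X] {Ω : Set X}
    (hΩ : Convex ℝ Ω) (x : X) : Convex ℝ ((fun y => y - x) '' Ω) := by
  simpa only [sub_eq_add_neg, add_comm] using hΩ.translate (-x)

theorem add_mem_affineSpan_of_mem_conicHull {X : Type*} [AddCommGroup X] [Module ℝ X]
    {Ω : Set X} {x z : X} (hx : x ∈ Ω) (hz : z ∈ conicHull ((fun y => y - x) '' Ω)) :
    x + z ∈ affineSpan ℝ Ω := by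
  obtain ⟨t, -, _, ⟨y, hy, rfl⟩, rfl⟩ := hz
  have := AffineMap.lineMap_mem (Q := affineSpan ℝ Ω) t (subset_affineSpan ℝ Ω hx)
    (subset_affineSpan ℝ Ω hy)
  simpa [AffineMap.lineMap_apply, add_comm] using this

theorem intrinsicRelativeInterior_subset_quasiRelativeInterior {X : Type*} [AddCommGroup X]
    [Module ℝ X] [TopologicalSpace X] [IsTopologicalAddGroup X] [ContinuousSMul ℝ X]
    (Ω : Set X) : intrinsicRelativeInterior Ω ⊆ quasiRelativeInterior Ω := by
  rintro x ⟨hx, S, hS⟩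
  exact ⟨hx, S.topologicalClosure, by rw [Submodule.topologicalClosure_coe, hS]⟩

/-- A convex set with nonempty interior has the same interior as its closure. -/
theorem Convex.eq_univ_of_dense_of_interior_nonempty {X : Type*} [AddCommGroup X]
    [Module ℝ X] [TopologicalSpace X] [IsTopologicalAddGroup X] [ContinuousSMul ℝ X]
    {K : Set X} (hK : Convex ℝ K) (hd : Dense K) (hi : (interior K).Nonempty) :
    K = Set.univ := by
  have h := hK.interior_closure_eq_interior_of_nonempty_interior hi
  rw [hd.closure_eq, interior_univ] at h
  exact Set.univ_subset_iff.mp (h ▸ interior_subset)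

theorem isQuasiRegular_of_relativeInterior_nonempty {X : Type*} [AddCommGroup X] [Module ℝ X]
    [TopologicalSpace X] [IsTopologicalAddGroup X] [ContinuousSMul ℝ X] {Ω : Set X}
    (hΩ : Convex ℝ Ω) (hri : (relativeInterior Ω).Nonempty) : IsQuasiRegular Ω := by
  refine Set.Subset.antisymm ?_ (intrinsicRelativeInterior_subset_quasiRelativeInterior Ω)
  rintro x ⟨hx, T, hT⟩
  refine ⟨hx, T, ?_⟩
  obtain ⟨x₀, hx₀, V, hV, hVΩ⟩ := hri
  set K := conicHull ((fun y => y - x) '' Ω)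
  have hKT : K ⊆ T := hT ▸ subset_closure
  have hΩK : ∀ y ∈ Ω, y - x ∈ K := fun y hy => subset_conicHull _ ⟨y, hy, rfl⟩
  have hTaff : ∀ z ∈ T, x + z ∈ closure (affineSpan ℝ Ω : Set X) := fun z hz =>
    map_mem_closure (f := fun z => x + z) (by fun_prop) (hT ▸ hz : z ∈ closure K)
      fun w hw => add_mem_affineSpan_of_mem_conicHull hx hw
  have hconv : Convex ℝ ((↑) ⁻¹' K : Set T) :=
    ((hΩ.image_sub_const x).conicHull).linear_preimage T.subtype
  have hdense : Dense ((↑) ⁻¹' K : Set T) := by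
    rw [Subtype.dense_iff]
    intro z hz
    have hzK : z ∈ closure K := hT ▸ hz
    exact closure_mono (fun w hw => ⟨⟨w, hKT hw⟩, hw, rfl⟩ : K ⊆ (↑) '' ((↑) ⁻¹' K : Set T)) hzK
  -- If `z ∈ T` is near `x₀ - x`, then `x + z` lies in `V` and, by `hTaff`, in the closed affine
  -- hull, hence in `Ω`.
  have hint : (interior ((↑) ⁻¹' K : Set T)).Nonempty := by
    refine ⟨⟨x₀ - x, hKT (hΩK _ hx₀)⟩, mem_interior_iff_mem_nhds.mpr ?_⟩
    have hc : ContinuousAt (fun z : T => x + (z : X)) ⟨x₀ - x, hKT (hΩK _ hx₀)⟩ := by fun_prop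
    filter_upwards [hc.preimage_mem_nhds (by simpa using hV)] with z hz
    simpa using hΩK _ (hVΩ ⟨hz, hTaff z z.2⟩)
  have huniv := hconv.eq_univ_of_dense_of_interior_nonempty hdense hint
  exact Set.Subset.antisymm
    (fun z hz => (huniv ▸ Set.mem_univ _ : (⟨z, hz⟩ : T) ∈ ((↑) ⁻¹' K : Set T))) hKT

theorem interior_subset_relativeInterior {X : Type*} [AddCommGroup X] [Module ℝ X]
    [TopologicalSpace X] (Ω : Set X) : interior Ω ⊆ relativeInterior Ω := fun _ hx =>
  ⟨interior_subset hx, Ω, mem_interior_iff_mem_nhds.mp hx, Set.inter_subset_left⟩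

/-- Affine subspaces are closed here, so intrinsic interior points lie in ri; a Euclidean model
provides one. -/
theorem Convex.relativeInterior_nonempty {X : Type*} [AddCommGroup X] [Module ℝ X]
    [TopologicalSpace X] [IsTopologicalAddGroup X] [ContinuousSMul ℝ X] [T2Space X]
    [FiniteDimensional ℝ X] {Ω : Set X} (hΩ : Convex ℝ Ω) (hne : Ω.Nonempty) :
    (relativeInterior Ω).Nonempty := by
  have himg := Set.Nonempty.intrinsicInterior
    (hΩ.linear_image (toEuclidean (E := X)).toLinearEquiv.toLinearMap) (hne.image _)
  have heq := (toEuclidean (E := X)).toContinuousAffineEquiv.intrinsicInterior_image Ω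
  obtain ⟨x, hx⟩ : (intrinsicInterior ℝ Ω).Nonempty := by
    rw [← Set.image_nonempty, ← heq]
    exact himg
  refine ⟨x, intrinsicInterior_subset hx, ?_⟩
  obtain ⟨y, hy, rfl⟩ := mem_intrinsicInterior.mp hx
  have hclosed : IsClosed (affineSpan ℝ Ω : Set X) := by
    have h : (affineSpan ℝ Ω : Set X) = (fun z => z - (y : X)) ⁻¹' (affineSpan ℝ Ω).direction := by
      ext z
      exact (AffineSubspace.vsub_right_mem_direction_iff_mem y.2 z).symm
    rw [h]
    exact (Submodule.closed_of_finiteDimensional _).preimage (by fun_prop)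
  obtain ⟨V, hV, hVs⟩ := (mem_nhds_subtype _ _ _).mp (mem_interior_iff_mem_nhds.mp hy)
  refine ⟨V, hV, ?_⟩
  rw [hclosed.closure_eq]
  exact fun z ⟨hzV, hz⟩ => hVs (a := ⟨z, hz⟩) hzV

theorem sub_mem_topologicalClosure_of_mem_closure_affineSpan {X : Type*} [AddCommGroup X]
    [Module ℝ X] [TopologicalSpace X] [IsTopologicalAddGroup X] [ContinuousSMul ℝ X]
    {Ω : Set X} {x : X} {S : Submodule ℝ X} (hS : ∀ y ∈ Ω, y - x ∈ S) {y : X}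
    (hy : y ∈ closure (affineSpan ℝ Ω : Set X)) : y - x ∈ S.topologicalClosure := by
  have hle : affineSpan ℝ Ω ≤ AffineSubspace.mk' x S :=
    affineSpan_le.mpr fun z hz => AffineSubspace.mem_mk'.mpr (hS z hz)
  exact map_mem_closure (f := fun z => z - x) (by fun_prop) hy
    fun z hz => AffineSubspace.mem_mk'.mp (hle hz)

/-- If `cone (Ω - x)` is dense in a subspace, then unit normals in that subspace at points
converging to `x` converge weakly to zero. -/
theorem tendsto_inner_of_forall_inner_sub_nonpos {X : Type*} [NormedAddCommGroup X]
    [InnerProductSpace ℝ X] [CompleteSpace X] {Ω : Set X} {x : X} {S : Submodule ℝ X}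
    (hS : (S : Set X) = conicHull ((fun y => y - x) '' Ω)) {p u : ℕ → X}
    (hp : Tendsto p atTop (𝓝 x)) (hu : ∀ k, ‖u k‖ = 1)
    (huS : ∀ k, u k ∈ S.topologicalClosure)
    (hn : ∀ k, ∀ y ∈ Ω, inner ℝ (u k) (y - p k) ≤ 0) (v : X) :
    Tendsto (fun k => inner ℝ (u k) v) atTop (𝓝 0) := by
  have hpx : Tendsto (fun k => ‖p k - x‖) atTop (𝓝 0) := tendsto_iff_norm_sub_tendsto_zero.mp hp
  have hbound : ∀ s ∈ S, ∃ C : ℝ, ∀ k, inner ℝ (u k) s ≤ C * ‖p k - x‖ := by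
    intro s hs
    obtain ⟨t, ht, _, ⟨y, hy, rfl⟩, rfl⟩ : s ∈ conicHull ((fun y => y - x) '' Ω) := hS ▸ hs
    refine ⟨t, fun k => ?_⟩
    have h1 : inner ℝ (u k) (y - x) ≤ ‖p k - x‖ := by
      have h2 : y - x = (y - p k) + (p k - x) := by abel
      have h3 := real_inner_le_norm (u k) (p k - x)
      rw [hu, one_mul] at h3
      rw [h2, inner_add_right]
      linarith [hn k y hy]
    rw [inner_smul_right]
    exact mul_le_mul_of_nonneg_left h1 ht
  have hlimS : ∀ s ∈ S, Tendsto (fun k => inner ℝ (u k) s) atTop (𝓝 0) := by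
    intro s hs
    obtain ⟨C, hC⟩ := hbound s hs
    -- Linearity of the cone enters here: `-s` is also in it, turning the one-sided bound into a
    -- two-sided one.
    obtain ⟨D, hD⟩ := hbound (-s) (S.neg_mem hs)
    refine tendsto_of_tendsto_of_tendsto_of_le_of_le (g := fun k => -(D * ‖p k - x‖))
      (h := fun k => C * ‖p k - x‖) (by simpa using (hpx.const_mul D).neg)
      (by simpa using hpx.const_mul C) (fun k => ?_) hC
    have := hD k
    rw [inner_neg_right] at this
    show -(D * ‖p k - x‖) ≤ _
    linarith
  have hlim : ∀ w ∈ S.topologicalClosure, Tendsto (fun k => inner ℝ (u k) w) atTop (𝓝 0) := by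
    intro w hw
    rw [Metric.tendsto_atTop]
    intro ε hε
    obtain ⟨s, hs, hws⟩ := Metric.mem_closure_iff.mp
      (show w ∈ closure (S : Set X) from hw) (ε / 2) (half_pos hε)
    obtain ⟨N, hN⟩ := Metric.tendsto_atTop.mp (hlimS s hs) (ε / 2) (half_pos hε)
    refine ⟨N, fun k hk => ?_⟩
    have h1 := hN k hk
    have h2 := abs_real_inner_le_norm (u k) (w - s)
    rw [Real.dist_eq, sub_zero] at h1 ⊢
    rw [hu, one_mul, inner_sub_right, ← dist_eq_norm] at h2
    linarith [abs_sub_abs_le_abs_sub (inner ℝ (u k) w) (inner ℝ (u k) s)]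
  have : S.topologicalClosure.HasOrthogonalProjection :=
    have : CompleteSpace S.topologicalClosure :=
      S.isClosed_topologicalClosure.completeSpace_coe
    inferInstance
  -- The orthogonal component is invisible to `u k`.
  obtain ⟨w, hw, z, hz, rfl⟩ := S.topologicalClosure.exists_add_mem_mem_orthogonal v
  refine (hlim w hw).congr fun k => ?_
  rw [inner_add_right, Submodule.inner_right_of_mem_orthogonal (huS k) hz, add_zero]

theorem IsSNCAt.mem_relativeInterior {X : Type*} [NormedAddCommGroup X]
    [InnerProductSpace ℝ X] [CompleteSpace X] {Ω : Set X} {x : X} (hΩ : Convex ℝ Ω)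
    (hcl : IsClosed Ω) (hsnc : IsSNCAt Ω x) (hx : x ∈ intrinsicRelativeInterior Ω) :
    x ∈ relativeInterior Ω := by
  obtain ⟨hxΩ, S, hS⟩ := hx
  refine ⟨hxΩ, ?_⟩
  by_contra! hcon
  have hΩS : ∀ y ∈ Ω, y - x ∈ S := fun y hy =>
    SetLike.mem_coe.mp (hS ▸ subset_conicHull _ ⟨y, hy, rfl⟩)
  have hex : ∀ k : ℕ, ∃ y ∈ closure (affineSpan ℝ Ω : Set X), y ∉ Ω ∧
      ‖y - x‖ < 1 / ((k : ℝ) + 1) := by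
    intro k
    obtain ⟨y, ⟨hyb, hy⟩, hyΩ⟩ := Set.not_subset.mp
      (hcon _ (Metric.ball_mem_nhds x (Nat.one_div_pos_of_nat (α := ℝ) (n := k))))
    exact ⟨y, hy, hyΩ, by simpa [dist_eq_norm] using hyb⟩
  choose y hy hyΩ hyx using hex
  -- Metric projections onto `Ω`: the residual `y k - p k` is a nonzero normal at `p k`.
  choose p hpΩ hp using fun k => exists_norm_eq_iInf_of_complete_convex ⟨x, hxΩ⟩
    hcl.isComplete hΩ (y k)
  have hproj := fun k => (norm_eq_iInf_iff_real_inner_le_zero hΩ (hpΩ k)).mp (hp k)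
  have hle : ∀ k, ‖y k - p k‖ ≤ ‖y k - x‖ := fun k => by
    rw [hp k]
    exact ciInf_le ⟨0, Set.forall_mem_range.2 fun _ => norm_nonneg _⟩ (⟨x, hxΩ⟩ : Ω)
  have hpx : Tendsto p atTop (𝓝 x) := by
    rw [tendsto_iff_norm_sub_tendsto_zero]
    refine squeeze_zero (g := fun k : ℕ => 2 * (1 / ((k : ℝ) + 1))) (fun _ => norm_nonneg _)
      (fun k => ?_) (by simpa using (tendsto_one_div_add_atTop_nhds_zero_nat (𝕜 := ℝ)).const_mul 2)
    have h1 : p k - x = (y k - x) - (y k - p k) := by abel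
    rw [h1]
    linarith [norm_sub_le (y k - x) (y k - p k), hle k, hyx k]
  have hne : ∀ k, y k - p k ≠ 0 := fun k h => hyΩ k (sub_eq_zero.mp h ▸ hpΩ k)
  let u : ℕ → X := fun k => ‖y k - p k‖⁻¹ • (y k - p k)
  have hu : ∀ k, ‖u k‖ = 1 := fun k => norm_smul_inv_norm (𝕜 := ℝ) (hne k)
  have huS : ∀ k, u k ∈ S.topologicalClosure := fun k => by
    refine Submodule.smul_mem _ _ ?_
    rw [← sub_sub_sub_cancel_right (y k) (p k) x]
    exact Submodule.sub_mem _ (sub_mem_topologicalClosure_of_mem_closure_affineSpan hΩS (hy k))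
      (S.le_topologicalClosure (hΩS _ (hpΩ k)))
  have hn : ∀ k, ∀ z ∈ Ω, inner ℝ (u k) (z - p k) ≤ 0 := fun k z hz => by
    rw [real_inner_smul_left]
    exact mul_nonpos_of_nonneg_of_nonpos (by positivity) (hproj k z hz)
  have hnull := hsnc p (fun k => InnerProductSpace.toDual ℝ X (u k)) hpΩ hpx
    (fun k => ⟨hpΩ k, fun z hz => by simpa using hn k z hz⟩)
    (tendsto_iff_forall_eval_tendsto_topDualPairing.mpr fun v =>
      tendsto_inner_of_forall_inner_sub_nonpos hS hpx hu huS hn v)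
  simp only [LinearIsometryEquiv.norm_map, hu] at hnull
  exact one_ne_zero (tendsto_nhds_unique tendsto_const_nhds hnull)

theorem theorem3p8 :
    -- (a) finite-dimensional spaces (with their Hausdorff vector topology)
    (∀ (X : Type u) [AddCommGroup X] [Module ℝ X] [TopologicalSpace X]
      [IsTopologicalAddGroup X] [ContinuousSMul ℝ X] [T2Space X] [FiniteDimensional ℝ X]
      (Ω : Set X), Ω.Nonempty → Convex ℝ Ω → IsQuasiRegular Ω) ∧
    -- (b) nonempty interior
    (∀ (X : Type u) [AddCommGroup X] [Module ℝ X] [TopologicalSpace X]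
      [IsTopologicalAddGroup X] [ContinuousSMul ℝ X] [LocallyConvexSpace ℝ X]
      (Ω : Set X), Ω.Nonempty → Convex ℝ Ω → (interior Ω).Nonempty → IsQuasiRegular Ω) ∧
    -- (c) nonempty relative interior
    (∀ (X : Type u) [AddCommGroup X] [Module ℝ X] [TopologicalSpace X]
      [IsTopologicalAddGroup X] [ContinuousSMul ℝ X] [LocallyConvexSpace ℝ X]
      (Ω : Set X), Ω.Nonempty → Convex ℝ Ω → (relativeInterior Ω).Nonempty →
      IsQuasiRegular Ω) ∧
    -- (d) Hilbert spaces
    (∀ (X : Type u) [NormedAddCommGroup X] [InnerProductSpace ℝ X] [CompleteSpace X]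
      (Ω : Set X), Ω.Nonempty → Convex ℝ Ω → IsClosed Ω → IsSNC Ω →
      (intrinsicRelativeInterior Ω).Nonempty → IsQuasiRegular Ω) := by
  refine ⟨?_, ?_, ?_, ?_⟩
  · intro X _ _ _ _ _ _ _ Ω hne hΩ
    exact isQuasiRegular_of_relativeInterior_nonempty hΩ (hΩ.relativeInterior_nonempty hne)
  · intro X _ _ _ _ _ _ Ω _ hΩ hint
    exact isQuasiRegular_of_relativeInterior_nonempty hΩ
      (hint.mono (interior_subset_relativeInterior Ω))
  · intro X _ _ _ _ _ _ Ω _ hΩ hri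
    exact isQuasiRegular_of_relativeInterior_nonempty hΩ hri
  · intro X _ _ _ Ω _ hΩ hcl hsnc hiri
    exact isQuasiRegular_of_relativeInterior_nonempty hΩ
      (hiri.mono fun x hx => (hsnc x hx.1).mem_relativeInterior hΩ hcl hx)
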